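/- Let $G$ be a finite undirected graph with vertex set $V$, where loops and real algebraic edge weights are allowed (a simple graph is the case in which all edge weights are $1$), and let $M\in\mathbb{R}^{V\times V}$ be its adjacency matrix. Let $T$ be an automorphism of $G$ of order $r$, let $K\subseteq V$ be an orbit of $T$ of cardinality $r$, and let $x_0\in K$. Let $D_K$ be the diagonal $V\times V$ matrix with diagonal entries $1$ on $K$ and $0$ outside $K$, let $Q\in\mathbb{R}$ be transcendental, and put $M^K=M+Q\cdot D_K$. With $\rho=e^{2\pi\mathrm{i}/r}$, for $k=1,\dots,r$ let $\hat v_k\in\mathbb{C}^V$ be the vector with entry $\rho^{mk}$ at $T^m x_0$ for $m=0,\dots,r-1$ and entry $0$ outside $K$, and let $P_k$ be the minimal polynomial of $M^K$ relative to $\hat v_k$, that is, the monic polynomial $p\in\mathbb{C}[t]$ of smallest degree with $p(M^K)\hat v_k=0$. Write $\operatorname{Tr}P$ for the sum of the roots of a polynomial $P$, counted with multiplicity. If $\deg P_i\neq\deg P_j$ or $\operatorname{Tr}P_i\neq\operatorname{Tr}P_j$ for some $i,j\in\{1,\dots,r\}$, then $M^K$ exhibits pretty good fractional revival with respect to $K$: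 the closure of the set $\{\exp(\mathrm{i}tM^K)_{K\times K} : t\geq 0\}$ of $K\times K$ submatrices contains a unitary $K\times K$ matrix that is not a scalar multiple of the identity. -/

import Mathlib

open scoped Polynomial

namespace PGFR

/-- An undirected graph on the vertex set `V`, given by its edge weights. Loops and real algebraic
weights are allowed, and weight `0` means that there is no edge. -/
structure WeightedGraph (V : Type*) where
  /-- The weight of the edge joining two vertices. -/
  weight : V → V → ℝ
  weight_comm : ∀ x y, weight x y = weight y x
  weight_algebraic : ∀ x y, IsAlgebraic ℚ (weight x y)

/-- The adjacency matrix of a graph. -/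
def WeightedGraph.adjMatrix {V : Type*} (G : WeightedGraph V) : Matrix V V ℝ :=
  Matrix.of G.weight

/-- A permutation of the vertices is an automorphism if it preserves adjacency (with weights). -/
def WeightedGraph.IsAutomorphism {V : Type*} (G : WeightedGraph V) (T : Equiv.Perm V) : Prop :=
  ∀ x y, G.weight (T x) (T y) = G.weight x y

open Classical in
/-- A simple graph is the graph all of whose edges have weight `1`. -/
noncomputable def WeightedGraph.ofSimpleGraph {V : Type*} (G : SimpleGraph V) :
    WeightedGraph V where
  weight x y := if G.Adj x y then 1 else 0
  weight_comm x y := by simp only [G.adj_comm x y]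
  weight_algebraic x y := by
    split_ifs
    · exact isAlgebraic_one
    · exact isAlgebraic_zero

theorem WeightedGraph.adjMatrix_ofSimpleGraph {V : Type*} (G : SimpleGraph V)
    [DecidableRel G.Adj] : (WeightedGraph.ofSimpleGraph G).adjMatrix = G.adjMatrix ℝ := by
  ext x y
  simp [WeightedGraph.adjMatrix, WeightedGraph.ofSimpleGraph, SimpleGraph.adjMatrix_apply]

theorem WeightedGraph.isAutomorphism_ofSimpleGraph {V : Type*} (G : SimpleGraph V)
    (T : Equiv.Perm V) : (WeightedGraph.ofSimpleGraph G).IsAutomorphism T ↔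
      ∀ x y, G.Adj (T x) (T y) ↔ G.Adj x y := by
  refine forall₂_congr fun x y => ?_
  by_cases h : G.Adj x y <;> by_cases h' : G.Adj (T x) (T y) <;>
    simp [WeightedGraph.ofSimpleGraph, h, h']

section

variable {X : Type*} [Fintype X] [DecidableEq X]

/-- The `K × K` block of an `X × X` matrix. -/
def block (A : Matrix X X ℂ) (K : Finset X) : Matrix K K ℂ :=
  A.submatrix Subtype.val Subtype.val

/-- The unitary group `exp (i t M)` of a real matrix `M`. -/
noncomputable def evolution (M : Matrix X X ℝ) (t : ℝ) : Matrix X X ℂ :=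
  NormedSpace.exp ((Complex.I * (t : ℂ)) • M.map ((↑) : ℝ → ℂ))

/-- Pretty good fractional revival with respect to `K`: the closure of the `K × K` blocks of
`exp (i t M)`, `t ≥ 0`, contains a unitary matrix that is not a multiple of the identity. -/
def HasPGFR (M : Matrix X X ℝ) (K : Finset X) : Prop :=
  ¬ (closure {B : Matrix K K ℂ | ∃ t : ℝ, 0 ≤ t ∧ B = block (evolution M t) K} ∩
        (Matrix.unitaryGroup K ℂ : Set (Matrix K K ℂ)) ⊆
      {B : Matrix K K ℂ | ∃ c : ℂ, B = c • (1 : Matrix K K ℂ)})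

/-- The diagonal `0`-`1` matrix `D_K`. -/
def diagIndicator (K : Finset X) : Matrix X X ℝ :=
  Matrix.diagonal fun x => if x ∈ K then 1 else 0

/-- Extension of a vector on `K` by zeros. -/
def zeroExtend {K : Finset X} (v : K → ℂ) : X → ℂ :=
  fun x => if h : x ∈ K then v ⟨x, h⟩ else 0

theorem exists_monic_annihilating (A : Matrix X X ℂ) (w : X → ℂ) :
    ∃ p : ℂ[X], p.Monic ∧ (Polynomial.aeval A p).mulVec w = 0 :=
  ⟨A.charpoly, A.charpoly_monic, by rw [Matrix.aeval_self_charpoly, Matrix.zero_mulVec]⟩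

/-- The minimal polynomial of `A` relative to the vector `w`: the monic polynomial `p` of smallest
degree such that `p(A) w = 0`. -/
noncomputable def relMinpoly (A : Matrix X X ℂ) (w : X → ℂ) : ℂ[X] :=
  Polynomial.degree_lt_wf.min
    {p : ℂ[X] | p.Monic ∧ (Polynomial.aeval A p).mulVec w = 0}
    (exists_monic_annihilating A w)

theorem relMinpoly_spec (A : Matrix X X ℂ) (w : X → ℂ) :
    (relMinpoly A w).Monic ∧ (Polynomial.aeval A (relMinpoly A w)).mulVec w = 0 :=
  Polynomial.degree_lt_wf.min_mem
    {p : ℂ[X] | p.Monic ∧ (Polynomial.aeval A p).mulVec w = 0} (exists_monic_annihilating A w)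

theorem degree_relMinpoly_le (A : Matrix X X ℂ) (w : X → ℂ) {q : ℂ[X]} (hq : q.Monic)
    (h : (Polynomial.aeval A q).mulVec w = 0) : (relMinpoly A w).degree ≤ q.degree :=
  not_lt.mp (Polynomial.degree_lt_wf.not_lt_min
    {p : ℂ[X] | p.Monic ∧ (Polynomial.aeval A p).mulVec w = 0} ⟨hq, h⟩)

/-- The trace of a polynomial: the sum of its complex roots with multiplicity. -/
noncomputable def polyTrace (p : ℂ[X]) : ℂ := p.roots.sum

/-- If `K` is the `T`-orbit of `x₀` and has `r` elements, this is the vector on `K` whose entry at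
`T ^ m x₀` is `ρ ^ (m k)` for `m = 0, …, r - 1`, where `ρ = exp (2 π i / r)`. -/
noncomputable def cyclicVec (T : Equiv.Perm X) (x₀ : X) (r : ℕ) (K : Finset X) (k : ℕ) : K → ℂ :=
  fun x => ∑ m ∈ Finset.range r,
    if (T ^ m) x₀ = x then Complex.exp (2 * Real.pi * Complex.I / r) ^ (m * k) else 0

/-- The perturbed matrix `M + Q D_K`. -/
def perturbed (M : Matrix X X ℝ) (Q : ℝ) (K : Finset X) : Matrix X X ℝ :=
  M + Q • diagIndicator K

/-- The polynomial `P_k`: the minimal polynomial of `M + Q D_K` relative to the vector `v_k`. -/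
noncomputable def cyclicFactor (M : Matrix X X ℝ) (Q : ℝ) (T : Equiv.Perm X) (x₀ : X) (r : ℕ)
    (K : Finset X) (k : ℕ) : ℂ[X] :=
  relMinpoly ((perturbed M Q K).map ((↑) : ℝ → ℂ)) (zeroExtend (cyclicVec T x₀ r K k))

end

end PGFR

/-!
Write `A = M + Q D_K` and `v_k` for the Fourier vectors on the orbit `K`. The idea is to construct
an additive function `g : ℝ → ℝ` that takes a constant value `θ_k` on the roots of each `P_k`, that
is, on the eigenvalues of `A` that occur in `v_k`, and such that `θ_i - θ_j = 1`. By Kronecker's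
theorem (`exists_time_exp_near`) there are times `t ≥ 0` for which `exp (i t l)` is close to
`exp (i g(l))` for all eigenvalues `l` of `A`, so the matrix `U` with the eigenvectors of `A` and
the eigenvalues `exp (i g(l))` is a limit of `exp (i t A)`. It multiplies `v_k` by `exp (i θ_k)`. As
the `v_k` span the vectors supported on `K`, the `K × K` block of `U` is unitary, and it is not scalar
because `exp i ≠ 1`.

To find `g`, let `F` be the field of algebraic numbers. For a vector `u` with the same eigenvalue
under the symmetry `T` as `v_k`, the vector `D_K u` is a multiple of `v_k`. Thus `D_K` has rank one
on the Krylov space of `v_k`, which gives `P_k = a - Q b`, where `a` is the minimal polynomial of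
`M` relative to `v_k` and `b` is an associated polynomial of `a`, monic of degree one less
(`relMinpoly_add_smul`). Both have coefficients in `F`, and they are coprime because `M` is
Hermitian (`isCoprime_associated_relMinpoly`). Being linear in `Q`, the polynomial `a - Q b` is
irreducible over `F(Q)` by Gauss's lemma (`irreducible_pencil`). Hence the normalized trace to
`F(Q)` takes the value `Tr P_k / deg P_k` at every root of `P_k`. Here `Tr P_k = Q + Tr a` with
`Tr a` algebraic and `Q` transcendental, so these values differ for `i` and `j` as soon as the
degrees or the traces differ, and composing the normalized trace with a
`ℚ`-linear functional that separates the two values yields `g` (`exists_phase`).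
-/

/-! ### Kronecker approximation -/

namespace PGFR

theorem sq_sum_cos_add_sq_sum_sin {Ω : Type*} (s : Finset Ω) (α : Ω → ℝ) :
    (∑ a ∈ s, Real.cos (α a)) ^ 2 + (∑ a ∈ s, Real.sin (α a)) ^ 2 =
      ∑ a ∈ s, ∑ b ∈ s, Real.cos (α a - α b) := by
  simp_rw [sq, Finset.sum_mul_sum, ← Finset.sum_add_distrib, Real.cos_sub]

theorem norm_sum_exp_sq {Ω : Type*} (s : Finset Ω) (α : Ω → ℝ) :
    ‖∑ a ∈ s, Complex.exp (α a * Complex.I)‖ ^ 2 =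
      ∑ a ∈ s, ∑ b ∈ s, Real.cos (α a - α b) := by
  rw [← sq_sum_cos_add_sq_sum_sin, Complex.sq_norm, Complex.normSq_apply, Complex.re_sum,
    Complex.im_sum]
  simp_rw [Complex.exp_ofReal_mul_I_re, Complex.exp_ofReal_mul_I_im, sq]

theorem le_integral_cos (ν θ T : ℝ) (hν : ν ≠ 0) :
    -(2 / |ν|) ≤ ∫ t in (0 : ℝ)..T, Real.cos (ν * t - θ) := by
  rw [intervalIntegral.integral_comp_mul_sub (fun x => Real.cos x) hν, integral_cos, smul_eq_mul]
  refine neg_le_of_abs_le ?_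
  rw [abs_mul, abs_inv, inv_mul_eq_div]
  gcongr
  refine (abs_sub _ _).trans ?_
  linarith [Real.abs_sin_le_one (ν * T - θ), Real.abs_sin_le_one (ν * 0 - θ)]

/-- Mean value argument: the mean over `t ≥ 0` of the square of the norm of the exponential sum
is the number of pairs of equal frequencies, whatever the additive phase `g` is. -/
theorem card_pairs_le_of_norm_sum_exp_le {Ω : Type*} [Fintype Ω] (g : ℝ →+ ℝ) (ν : Ω → ℝ) {B : ℝ}
    (hB : ∀ t : ℝ, 0 ≤ t →
      ‖∑ a, Complex.exp ((ν a * t - g (ν a) : ℝ) * Complex.I)‖ ≤ B) :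
    (∑ a, ∑ b, if ν a = ν b then (1 : ℝ) else 0) ≤ B ^ 2 := by
  set C : ℝ := ∑ a, ∑ b, if ν a = ν b then (0 : ℝ) else 2 / |ν a - ν b|
  set E : ℝ := ∑ a, ∑ b, if ν a = ν b then (1 : ℝ) else 0
  have key : ∀ T : ℝ, 0 ≤ T → T * E - C ≤ T * B ^ 2 := by
    intro T hT
    have h1 : ∫ t in (0 : ℝ)..T, (∑ a, ∑ b, Real.cos ((ν a - ν b) * t - g (ν a - ν b))) ≤
        ∫ _t in (0 : ℝ)..T, B ^ 2 := by
      refine intervalIntegral.integral_mono_on hT ?_ (by simp) ?_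
      · exact Continuous.intervalIntegrable (by fun_prop) _ _
      · intro t ht
        calc _ = ‖∑ a, Complex.exp ((ν a * t - g (ν a) : ℝ) * Complex.I)‖ ^ 2 := by
              rw [norm_sum_exp_sq]
              refine Finset.sum_congr rfl fun a _ => Finset.sum_congr rfl fun b _ => ?_
              rw [map_sub]
              congr 1
              ring
          _ ≤ B ^ 2 := by gcongr; exact hB t ht.1
    rw [intervalIntegral.integral_const, sub_zero, smul_eq_mul,
      intervalIntegral.integral_finsetSum
        (fun _ _ => Continuous.intervalIntegrable (by fun_prop) _ _)] at h1
    refine le_trans ?_ h1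
    rw [Finset.mul_sum, ← Finset.sum_sub_distrib]
    refine Finset.sum_le_sum fun a _ => ?_
    rw [intervalIntegral.integral_finsetSum
        (fun _ _ => Continuous.intervalIntegrable (by fun_prop) _ _), Finset.mul_sum,
        ← Finset.sum_sub_distrib]
    refine Finset.sum_le_sum fun b _ => ?_
    split_ifs with hab
    · simp [hab]
    · simpa using le_integral_cos _ (g (ν a - ν b)) T (sub_ne_zero.mpr hab)
  by_contra! hlt
  -- For `T = (|C| + 1) / (E - B ^ 2)` the error `C` is outweighed.
  have h2 := key ((|C| + 1) / (E - B ^ 2)) (by have := sub_pos.mpr hlt; positivity)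
  have h3 : (|C| + 1) / (E - B ^ 2) * (E - B ^ 2) = |C| + 1 :=
    div_mul_cancel₀ _ (sub_pos.mpr hlt).ne'
  rw [mul_sub] at h3
  linarith [le_abs_self C]

theorem card_sq_le_card_mul_card_pairs {Ω κ : Type*} [Fintype Ω] [Fintype κ] [DecidableEq κ]
    (f : Ω → κ) :
    (Fintype.card Ω : ℝ) ^ 2 ≤
      Fintype.card κ * ∑ a, ∑ b, if f a = f b then (1 : ℝ) else 0 := by
  have h1 : (Fintype.card Ω : ℝ) = ∑ c : κ, ∑ a : Ω, if f a = c then (1 : ℝ) else 0 := by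
    rw [Finset.sum_comm]; simp
  have h2 : (∑ a, ∑ b, if f a = f b then (1 : ℝ) else 0) =
      ∑ c : κ, (∑ a : Ω, if f a = c then (1 : ℝ) else 0) ^ 2 := by
    simp_rw [sq, Finset.sum_mul_sum]
    rw [Finset.sum_comm]
    conv_rhs => rw [Finset.sum_comm]
    rw [Finset.sum_comm]
    refine Finset.sum_congr rfl fun a _ => ?_
    rw [Finset.sum_comm]
    refine Finset.sum_congr rfl fun b _ => ?_
    simp [eq_comm]
  rw [h1, h2]
  exact sq_sum_le_card_mul_sum_sq

/-- The `N`-th power of an exponential sum with frequencies `μ` has frequencies indexed by words of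
length `N`; a frequency depends only on the letter counts, so few frequencies occur. -/
theorem card_pow_le_of_norm_sum_exp_le {J : Type*} [Fintype J] [DecidableEq J] (g : ℝ →+ ℝ)
    (μ : J → ℝ) {B : ℝ}
    (hB : ∀ t : ℝ, 0 ≤ t →
      ‖∑ a, Complex.exp ((μ a * t - g (μ a) : ℝ) * Complex.I)‖ ≤ B) (N : ℕ) :
    ((Fintype.card J : ℝ) ^ N) ^ 2 ≤ ((N : ℝ) + 1) ^ Fintype.card J * (B ^ N) ^ 2 := by
  classical
  let ν : (Fin N → J) → ℝ := fun w => ∑ i, μ (w i)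
  have h1 := card_pairs_le_of_norm_sum_exp_le g ν (B := B ^ N) (by
    intro t ht
    refine le_trans (le_of_eq ?_) (pow_le_pow_left₀ (norm_nonneg _) (hB t ht) N)
    rw [← norm_pow, Fintype.sum_pow]
    congr 1
    refine Finset.sum_congr rfl fun w _ => ?_
    rw [← Complex.exp_sum, ← Finset.sum_mul, ← Complex.ofReal_sum, Finset.sum_sub_distrib,
      ← Finset.sum_mul, map_sum])
  -- The number of occurrences of each letter in a word.
  let f : (Fin N → J) → (J → Fin (N + 1)) := fun w j =>
    ⟨(Finset.univ.filter fun i => w i = j).card,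
      Nat.lt_succ_of_le ((Finset.card_le_univ _).trans (by simp))⟩
  have hf : ∀ w w', f w = f w' → ν w = ν w' := by
    intro w w' h
    have hν : ∀ w, ν w = ∑ j, (f w j : ℕ) * μ j := by
      intro w
      change ∑ i, μ (w i) = _
      rw [← Finset.sum_fiberwise_of_maps_to (s := Finset.univ) (t := Finset.univ) (g := w)
        (by simp)]
      refine Finset.sum_congr rfl fun j _ => ?_
      rw [Finset.sum_congr rfl (g := fun _ => μ j)
        (fun i hi => by rw [(Finset.mem_filter.mp hi).2])]
      simp [f]
    rw [hν, hν, h]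
  have h2 := card_sq_le_card_mul_card_pairs f
  have h3 : (∑ a, ∑ b, if f a = f b then (1 : ℝ) else 0) ≤ (B ^ N) ^ 2 := by
    refine le_trans ?_ h1
    refine Finset.sum_le_sum fun a _ => Finset.sum_le_sum fun b _ => ?_
    by_cases h : f a = f b
    · simp [h, hf a b h]
    · simp only [h, if_false]; split_ifs <;> norm_num
  refine (le_of_eq ?_).trans (h2.trans (le_trans (mul_le_mul_of_nonneg_left h3 (by positivity))
    (le_of_eq ?_)))
  · simp
  · simp

/-- An exponential sum whose phases are given by an additive function of the frequencies comes
arbitrarily close to its trivial bound, because its even powers have means that are too large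
otherwise. -/
theorem exists_lt_norm_sum_exp {J : Type*} [Fintype J] [Nonempty J] (g : ℝ →+ ℝ) (μ : J → ℝ)
    {δ : ℝ} (hδ : 0 < δ) : ∃ t : ℝ, 0 ≤ t ∧
      Fintype.card J - δ < ‖∑ a, Complex.exp ((μ a * t - g (μ a) : ℝ) * Complex.I)‖ := by
  classical
  by_contra! hB
  have hB0 : 0 ≤ (Fintype.card J : ℝ) - δ := (norm_nonneg _).trans (hB 0 le_rfl)
  have hc0 : (0 : ℝ) < Fintype.card J := by exact_mod_cast Fintype.card_pos
  set r : ℝ := ((Fintype.card J - δ) / Fintype.card J) ^ 2 with hr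
  have hr0 : 0 ≤ r := by positivity
  have hr1 : r < 1 := by
    refine pow_lt_one₀ (by positivity) ?_ two_ne_zero
    rw [div_lt_one hc0]
    linarith
  have hlim := (tendsto_pow_const_mul_const_pow_of_lt_one (Fintype.card J) hr0 hr1).const_mul
    ((2 : ℝ) ^ Fintype.card J)
  rw [mul_zero] at hlim
  obtain ⟨N, hN, hN1⟩ := ((hlim.eventually_lt_const one_pos).and
    (Filter.eventually_ge_atTop 1)).exists
  have hpow := card_pow_le_of_norm_sum_exp_le g μ hB N
  have hN1' : (1 : ℝ) ≤ N := by exact_mod_cast hN1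
  have h1 : ((N : ℝ) + 1) ^ Fintype.card J ≤ 2 ^ Fintype.card J * (N : ℝ) ^ Fintype.card J := by
    rw [← mul_pow]
    gcongr
    linarith
  have h2 : ((Fintype.card J - δ) ^ N) ^ 2 = r ^ N * ((Fintype.card J : ℝ) ^ N) ^ 2 := by
    rw [hr, ← pow_mul, ← pow_mul, ← pow_mul, mul_comm 2 N, ← mul_pow, div_mul_cancel₀ _ hc0.ne']
  have h3 : 0 < ((Fintype.card J : ℝ) ^ N) ^ 2 := by positivity
  rw [h2] at hpow
  have h4 : ((N : ℝ) + 1) ^ Fintype.card J * (r ^ N * ((Fintype.card J : ℝ) ^ N) ^ 2) ≤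
      2 ^ Fintype.card J * (N : ℝ) ^ Fintype.card J * (r ^ N * ((Fintype.card J : ℝ) ^ N) ^ 2) := by
    gcongr
  nlinarith

theorem norm_one_sub_sq_of_norm_eq_one {z : ℂ} (hz : ‖z‖ = 1) :
    ‖1 - z‖ ^ 2 = 4 - ‖1 + z‖ ^ 2 := by
  have h := parallelogram_law_with_norm ℝ (1 : ℂ) z
  rw [hz, norm_one] at h
  linarith

/-- **Kronecker's approximation theorem** in dual form: the phases of any additive map `g` on
finitely many frequencies are approximated by the phases at a single nonnegative time. -/
theorem exists_time_exp_near {ι : Type*} [Fintype ι] (g : ℝ →+ ℝ) (μ : ι → ℝ) {ε : ℝ}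
    (hε : 0 < ε) : ∃ t : ℝ, 0 ≤ t ∧ ∀ a,
      ‖Complex.exp (Complex.I * t * μ a) - Complex.exp (Complex.I * g (μ a))‖ < ε := by
  classical
  -- The additional frequency `0` forces every other summand to be close to `1`.
  obtain ⟨t, ht, h⟩ := exists_lt_norm_sum_exp g (fun o : Option ι => o.elim 0 μ)
    (δ := ε ^ 2 / 4) (by positivity)
  refine ⟨t, ht, fun a => ?_⟩
  set z : ι → ℂ := fun a => Complex.exp ((μ a * t - g (μ a) : ℝ) * Complex.I) with hz
  have hz1 : ∀ a, ‖z a‖ = 1 := fun a => Complex.norm_exp_ofReal_mul_I _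
  have hdiff : Complex.exp (Complex.I * t * μ a) - Complex.exp (Complex.I * g (μ a)) =
      -(Complex.exp (g (μ a) * Complex.I) * (1 - z a)) := by
    rw [hz, mul_sub, ← Complex.exp_add]
    push_cast
    ring_nf
  rw [hdiff, norm_neg, norm_mul, Complex.norm_exp_ofReal_mul_I, one_mul]
  have hsum : ‖∑ o : Option ι, Complex.exp
      (((fun o : Option ι => o.elim 0 μ) o * t - g ((fun o : Option ι => o.elim 0 μ) o) : ℝ) *
        Complex.I)‖ ≤ ‖1 + z a‖ + (Fintype.card ι - 1) := by
    rw [Fintype.sum_option, ← Finset.add_sum_erase _ _ (Finset.mem_univ a), ← add_assoc]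
    refine (norm_add_le _ _).trans (add_le_add (le_of_eq ?_) ((norm_sum_le _ _).trans ?_))
    · simp [hz]
    · refine (Finset.sum_congr rfl (g := fun _ => (1 : ℝ)) (fun b _ => hz1 b)).le.trans ?_
      rw [Finset.sum_const, Finset.card_erase_of_mem (Finset.mem_univ a), nsmul_one,
        Nat.cast_sub (Finset.card_pos.mpr ⟨a, Finset.mem_univ a⟩)]
      simp
  have hcard : (Fintype.card (Option ι) : ℝ) = Fintype.card ι + 1 := by simp
  have h1 : 2 - ε ^ 2 / 4 < ‖1 + z a‖ := by
    have := h.trans_le hsum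
    rw [hcard] at this
    linarith
  have h2 : ‖1 + z a‖ ≤ 2 := (norm_add_le _ _).trans (by rw [hz1, norm_one]; norm_num)
  have h3 := norm_one_sub_sq_of_norm_eq_one (hz1 a)
  refine lt_of_pow_lt_pow_left₀ 2 hε.le ?_
  nlinarith [norm_nonneg (1 + z a)]

end PGFR

/-! ### Irreducibility of pencils of polynomials -/

namespace PGFR

open Polynomial IntermediateField
open scoped IntermediateField.algebraAdjoinAdjoin

section Pencil

variable {F Ω : Type*} [Field F] [Field Ω] [Algebra F Ω]

/-- The polynomial `a - y b` over an `F`-algebra with a distinguished element `y`. -/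
noncomputable def pencil {A : Type*} [CommRing A] [Algebra F A] (a b : F[X]) (y : A) : A[X] :=
  a.map (algebraMap F A) - C y * b.map (algebraMap F A)

theorem pencil_map {A B : Type*} [CommRing A] [Algebra F A] [CommRing B] [Algebra F B]
    [Algebra A B] [IsScalarTower F A B] (a b : F[X]) (y : A) :
    (pencil a b y).map (algebraMap A B) = pencil a b (algebraMap A B y) := by
  simp [pencil, Polynomial.map_map, ← IsScalarTower.algebraMap_eq]

theorem pencil_monic {A : Type*} [CommRing A] [Nontrivial A] [Algebra F A] {a b : F[X]}
    (ha : a.Monic) (hdeg : b.degree < a.degree) (y : A) : (pencil a b y).Monic := by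
  refine (ha.map _).sub_of_left ?_
  rw [degree_map]
  rw [← smul_eq_C_mul]
  exact (degree_smul_le _ _).trans_lt (by rwa [degree_map])

theorem pencil_natDegree {A : Type*} [CommRing A] [Nontrivial A] [Algebra F A] {a b : F[X]}
    (hdeg : b.degree < a.degree) (y : A) : (pencil a b y).natDegree = a.natDegree := by
  refine natDegree_eq_of_degree_eq ?_
  rw [pencil, degree_sub_eq_left_of_degree_lt, degree_map]
  rw [degree_map]
  rw [← smul_eq_C_mul]
  exact (degree_smul_le _ _).trans_lt (by rwa [degree_map])

/-- For coprime `a` and `b` the pencil `a - y b` is irreducible over `F[y]`: exchanging the two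
variables makes it a primitive polynomial of degree one. -/
theorem irreducible_pencil_X {a b : F[X]} (hb : b ≠ 0) (hab : IsCoprime a b) :
    Irreducible (pencil a b (X : F[X])) := by
  have h : pencil a b (X : F[X]) = Bivariate.swap (C (-b) * X + C a) := by
    rw [map_add, map_mul, Bivariate.swap_Y, Bivariate.swap_C, Bivariate.swap_C, pencil]
    simp only [algebraMap_eq, Polynomial.map_neg]
    ring
  rw [h, MulEquiv.irreducible_iff]
  exact irreducible_C_mul_X_add_C (neg_ne_zero.mpr hb)
    ((IsCoprime.neg_right_iff _ _).mpr hab).symm.isRelPrime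

/-- For coprime `a` and `b` and a transcendental `Q`, the polynomial `a - Q b` is irreducible over
`F(Q)`. -/
theorem irreducible_pencil {a b : F[X]} (ha : a.Monic) (hb : b ≠ 0) (hab : IsCoprime a b)
    (hdeg : b.degree < a.degree) {Q : Ω} (hQ : Transcendental F Q) :
    Irreducible (pencil a b (AdjoinSimple.gen F Q)) := by
  have : UniqueFactorizationMonoid (Algebra.adjoin F {Q}) := hQ.uniqueFactorizationMonoid_adjoin
  let e := Polynomial.algEquivOfTranscendental F Q hQ
  have he : (pencil a b (X : F[X])).mapEquiv e.toRingEquiv =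
      pencil a b (⟨Q, Algebra.self_mem_adjoin_singleton F Q⟩ : Algebra.adjoin F {Q}) := by
    simp only [pencil, mapEquiv_apply, Polynomial.map_sub, Polynomial.map_mul, map_C,
      Polynomial.map_map]
    congr 2
    · ext; simp [e]
    · congr 1
      simp [e]
    · congr 1; ext; simp [e]
  have h1 : Irreducible (pencil a b (⟨Q, Algebra.self_mem_adjoin_singleton F Q⟩ :
      Algebra.adjoin F {Q})) := by
    rw [← he, MulEquiv.irreducible_iff]
    exact irreducible_pencil_X hb hab
  have h2 := (pencil_monic ha hdeg _).irreducible_iff_irreducible_map_fraction_map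
    (K := F⟮Q⟯) |>.mp h1
  rw [pencil_map] at h2
  exact h2

end Pencil
end PGFR

/-! ### Relative minimal polynomials under perturbation -/

namespace PGFR

open Polynomial
open scoped ComplexOrder

section Associated

variable {R : Type*} [CommRing R]

/-- The functional `∑ qₙ Xⁿ ↦ ∑ qₙ cₙ` with moments `c`. -/
noncomputable def momentFunctional (c : ℕ → R) : R[X] →ₗ[R] R :=
  Polynomial.lsum fun n => (LinearMap.id : R →ₗ[R] R).smulRight (c n)

/-- The image of `Xⁿ` under `associated c`, namely `∑_{i < n} c_{n-1-i} X ^ i`. -/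
noncomputable def associatedPow (c : ℕ → R) : ℕ → R[X]
  | 0 => 0
  | n + 1 => X * associatedPow c n + C (c n)

/-- The associated polynomial of `q`, obtained from `(q(s) - q(t)) / (s - t)` by applying the
functional with moments `c` in the variable `t`. -/
noncomputable def associated (c : ℕ → R) : R[X] →ₗ[R] R[X] :=
  Polynomial.lsum fun n => (LinearMap.id : R →ₗ[R] R).smulRight (associatedPow c n)

theorem momentFunctional_monomial (c : ℕ → R) (n : ℕ) (a : R) :
    momentFunctional c (monomial n a) = a * c n := by
  simp [momentFunctional, Polynomial.lsum_apply]

theorem associated_monomial (c : ℕ → R) (n : ℕ) (a : R) :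
    associated c (monomial n a) = C a * associatedPow c n := by
  simp [associated, Polynomial.lsum_apply, smul_eq_C_mul]

theorem associated_X_mul (c : ℕ → R) (q : R[X]) :
    associated c (X * q) = X * associated c q + C (momentFunctional c q) := by
  induction q using Polynomial.induction_on' with
  | add p q hp hq =>
    rw [mul_add, map_add, map_add, map_add, hp, hq, C_add]
    ring
  | monomial n a =>
    rw [X_mul_monomial, associated_monomial, associated_monomial, momentFunctional_monomial,
      associatedPow, C_mul]
    ring

theorem coeff_associatedPow (c : ℕ → R) (n m : ℕ) :
    (associatedPow c n).coeff m = if m < n then c (n - 1 - m) else 0 := by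
  induction n generalizing m with
  | zero => simp [associatedPow]
  | succ n ih =>
    rcases m with _ | m
    · simp [associatedPow]
    · rw [associatedPow, coeff_add, coeff_X_mul, ih, coeff_C_succ, add_zero]
      simp only [Nat.add_lt_add_iff_right, Nat.add_sub_cancel]
      congr 2
      omega

theorem coeff_associated (c : ℕ → R) (q : R[X]) (m : ℕ) :
    (associated c q).coeff m =
      q.sum fun n a => a * if m < n then c (n - 1 - m) else 0 := by
  simp [associated, Polynomial.lsum_apply, Polynomial.sum_def, coeff_associatedPow]

theorem degree_associated_lt (c : ℕ → R) {q : R[X]} (hq : q ≠ 0) :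
    (associated c q).degree < q.degree := by
  rw [degree_eq_natDegree hq, degree_lt_iff_coeff_zero]
  intro m hm
  rw [coeff_associated, Polynomial.sum_def]
  refine Finset.sum_eq_zero fun n hn => ?_
  rw [if_neg (by have := le_natDegree_of_mem_supp n hn; omega), mul_zero]

theorem coeff_associated_of_monic (c : ℕ → R) {q : R[X]} (hq : q.Monic) {m : ℕ}
    (hm : q.natDegree = m + 1) : (associated c q).coeff m = c 0 := by
  rw [coeff_associated, Polynomial.sum_def, Finset.sum_eq_single (m + 1)]
  · rw [← hm, hq.coeff_natDegree]
    simp [hm]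
  · intro n hn hne
    rw [if_neg (by have := le_natDegree_of_mem_supp n hn; omega), mul_zero]
  · intro h
    rw [notMem_support_iff.mp h, zero_mul]

theorem associatedPow_map {S : Type*} [CommRing S] (f : R →+* S) (c : ℕ → R) (n : ℕ) :
    (associatedPow c n).map f = associatedPow (f ∘ c) n := by
  induction n with
  | zero => simp [associatedPow]
  | succ n ih => simp [associatedPow, ih]

theorem associated_map {S : Type*} [CommRing S] (f : R →+* S) (c : ℕ → R) (q : R[X]) :
    (associated c q).map f = associated (f ∘ c) (q.map f) := by
  induction q using Polynomial.induction_on' with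
  | add p q hp hq => simp [hp, hq]
  | monomial n a => simp [associated_monomial, associatedPow_map]

end Associated

section Krylov

theorem star_dotProduct_mulVec_of_isHermitian {X : Type*} [Fintype X]
    {N : Matrix X X ℂ} (hN : N.IsHermitian)
    (u v : X → ℂ) : star (N.mulVec u) ⬝ᵥ v = star u ⬝ᵥ N.mulVec v := by
  rw [Matrix.star_mulVec, hN.eq, Matrix.dotProduct_mulVec]

variable {X : Type*} [Fintype X] [DecidableEq X]

theorem relMinpoly_dvd {A : Matrix X X ℂ} {w : X → ℂ} {q : ℂ[X]}
    (hq : (aeval A q).mulVec w = 0) : relMinpoly A w ∣ q := by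
  obtain ⟨hm, hp⟩ := relMinpoly_spec A w
  rw [← modByMonic_eq_zero_iff_dvd hm]
  by_contra hr
  have hr0 : (aeval A (q %ₘ relMinpoly A w)).mulVec w = 0 := by
    have h := congrArg (fun p => (aeval A p).mulVec w) (modByMonic_add_div q (relMinpoly A w))
    rw [mul_comm (relMinpoly A w), map_add, map_mul, Matrix.add_mulVec, ← Matrix.mulVec_mulVec,
      hp, Matrix.mulVec_zero, add_zero] at h
    rw [h, hq]
  have h := degree_relMinpoly_le A w (monic_mul_leadingCoeff_inv hr) (by
    rw [mul_comm, map_mul, ← Matrix.mulVec_mulVec, hr0, Matrix.mulVec_zero])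
  rw [degree_mul_leadingCoeff_inv _ hr] at h
  exact absurd h (not_le.mpr (degree_modByMonic_lt _ hm))

theorem relMinpoly_natDegree_le {A : Matrix X X ℂ} {w : X → ℂ} {q : ℂ[X]} (hm : q.Monic)
    (hq : (aeval A q).mulVec w = 0) : (relMinpoly A w).natDegree ≤ q.natDegree :=
  natDegree_le_of_dvd (relMinpoly_dvd hq) hm.ne_zero

theorem natDegree_relMinpoly_pos (A : Matrix X X ℂ) {w : X → ℂ} (hw : w ≠ 0) :
    0 < (relMinpoly A w).natDegree := by
  obtain ⟨hm, hp⟩ := relMinpoly_spec A w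
  refine Nat.pos_of_ne_zero fun h => hw ?_
  rw [hm.natDegree_eq_zero.mp h, map_one, Matrix.one_mulVec] at hp
  exact hp

theorem mulVec_aeval_eq_momentFunctional_smul {N D : Matrix X X ℂ} {w : X → ℂ} {c : ℕ → ℂ}
    (h : ∀ n, D.mulVec ((N ^ n).mulVec w) = c n • w) (q : ℂ[X]) :
    D.mulVec ((aeval N q).mulVec w) = momentFunctional c q • w := by
  induction q using Polynomial.induction_on' with
  | add p q hp hq => rw [map_add, map_add, Matrix.add_mulVec, Matrix.mulVec_add, hp, hq, add_smul]
  | monomial n a =>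
    rw [aeval_monomial, ← Algebra.smul_def, Matrix.smul_mulVec, Matrix.mulVec_smul, h,
      momentFunctional_monomial, mul_smul]

/-- Rewriting a Krylov vector `q(N) w` as a Krylov vector of the perturbed matrix `N + y D`. -/
theorem aeval_pencil_mulVec {N D : Matrix X X ℂ} {w : X → ℂ} {c : ℕ → ℂ}
    (h : ∀ n, D.mulVec ((N ^ n).mulVec w) = c n • w) (y : ℂ) (q : ℂ[X]) :
    (aeval (N + y • D) (q - C y * associated c q)).mulVec w = (aeval N q).mulVec w := by
  have hpow : ∀ n : ℕ, (aeval (N + y • D) (Polynomial.X ^ n - C y * associatedPow c n)).mulVec w =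
      (N ^ n).mulVec w := by
    intro n
    induction n with
    | zero => simp [associatedPow]
    | succ n ih =>
      have hs : Polynomial.X ^ (n + 1) - C y * associatedPow c (n + 1) =
          Polynomial.X * (Polynomial.X ^ n - C y * associatedPow c n) - C (y * c n) := by
        rw [associatedPow, C_mul]
        ring
      rw [hs, map_sub, map_mul, aeval_X, Matrix.sub_mulVec, ← Matrix.mulVec_mulVec, ih, aeval_C,
        Matrix.add_mulVec, Matrix.smul_mulVec, h, pow_succ', ← Matrix.mulVec_mulVec,
        Algebra.algebraMap_eq_smul_one, Matrix.smul_mulVec, Matrix.one_mulVec, mul_smul]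
      abel
  induction q using Polynomial.induction_on' with
  | add p q hp hq =>
    have hs : p + q - C y * associated c (p + q) =
        (p - C y * associated c p) + (q - C y * associated c q) := by
      rw [map_add]
      ring
    rw [hs, map_add, map_add, Matrix.add_mulVec, Matrix.add_mulVec, hp, hq]
  | monomial n a =>
    have hs : monomial n a - C y * associated c (monomial n a) =
        C a * (Polynomial.X ^ n - C y * associatedPow c n) := by
      rw [associated_monomial, ← C_mul_X_pow_eq_monomial]
      ring
    rw [hs, map_mul, ← Matrix.mulVec_mulVec, hpow, Matrix.mulVec_mulVec, aeval_monomial, aeval_C]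

theorem monic_sub_associated (c : ℕ → ℂ) {q : ℂ[X]} (hq : q.Monic) (y : ℂ) :
    (q - C y * associated c q).Monic ∧
      (q - C y * associated c q).natDegree = q.natDegree := by
  have h : (C y * associated c q).degree < q.degree := by
    rw [← smul_eq_C_mul]
    exact (degree_smul_le _ _).trans_lt (degree_associated_lt c hq.ne_zero)
  exact ⟨hq.sub_of_left h, natDegree_eq_of_degree_eq (degree_sub_eq_left_of_degree_lt h)⟩

/-- On the Krylov space of `w` the matrix `D` has rank at most one. Adding `y D` changes the minimal
polynomial relative to `w` from `a` to `a - y b`, where `b` is the associated polynomial of `a`. -/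
theorem relMinpoly_add_smul {N D : Matrix X X ℂ} {w : X → ℂ} {c c' : ℕ → ℂ} {y : ℂ}
    (h : ∀ n, D.mulVec ((N ^ n).mulVec w) = c n • w)
    (h' : ∀ n, D.mulVec (((N + y • D) ^ n).mulVec w) = c' n • w) :
    relMinpoly (N + y • D) w =
      relMinpoly N w - C y * associated c (relMinpoly N w) := by
  obtain ⟨hm, hp⟩ := relMinpoly_spec N w
  obtain ⟨hm', hp'⟩ := relMinpoly_spec (N + y • D) w
  obtain ⟨hs, hsd⟩ := monic_sub_associated c hm y
  obtain ⟨hs', hsd'⟩ := monic_sub_associated c' hm' (-y)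
  have hN : N + y • D + (-y) • D = N := by rw [neg_smul, add_neg_cancel_right]
  have hback := aeval_pencil_mulVec h' (-y) (relMinpoly (N + y • D) w)
  rw [hN, hp'] at hback
  -- The perturbation can be undone, so the degrees of the two minimal polynomials agree.
  have hle := relMinpoly_natDegree_le hs' hback
  refine (eq_of_monic_of_dvd_of_natDegree_le hm' hs (relMinpoly_dvd ?_) ?_).symm
  · rw [aeval_pencil_mulVec h, hp]
  · omega

/-- At a common root of `a` and its associated polynomial there would be an eigenvector of `N` in
the Krylov space of `w` that is orthogonal to `w`, hence orthogonal to that whole space. -/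
theorem isCoprime_associated_relMinpoly {N D : Matrix X X ℂ} {w : X → ℂ} {c : ℕ → ℂ}
    (hN : N.IsHermitian) (hD : D.IsHermitian) (hDw : D.mulVec w = w)
    (h : ∀ n, D.mulVec ((N ^ n).mulVec w) = c n • w) :
    IsCoprime (relMinpoly N w) (associated c (relMinpoly N w)) := by
  obtain ⟨hm, hp⟩ := relMinpoly_spec N w
  rw [Polynomial.isCoprime_iff_aeval_ne_zero_of_isAlgClosed ℂ ℂ]
  by_contra! hcon
  obtain ⟨s, hs, hs'⟩ := hcon
  rw [coe_aeval_eq_eval] at hs hs'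
  obtain ⟨q, hq⟩ := dvd_iff_isRoot.mpr hs
  -- The eigenvector of `N` for the common root `s`.
  set u := (aeval N q).mulVec w with hu
  have hq0 : q ≠ 0 := by
    rintro rfl
    exact hm.ne_zero (by rw [hq, mul_zero])
  have hu0 : u ≠ 0 := by
    intro h0
    have hd := degree_le_of_dvd (relMinpoly_dvd h0) hq0
    rw [hq, degree_mul, degree_X_sub_C, degree_eq_natDegree hq0] at hd
    norm_cast at hd
    omega
  have hNu : N.mulVec u = s • u := by
    rw [hq, map_mul, ← Matrix.mulVec_mulVec, ← hu, map_sub, aeval_X, aeval_C, Matrix.sub_mulVec,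
      Algebra.algebraMap_eq_smul_one, Matrix.smul_mulVec, Matrix.one_mulVec, sub_eq_zero] at hp
    exact hp
  have hDu : D.mulVec u = 0 := by
    have hmom : momentFunctional c q = 0 := by
      have : associated c (relMinpoly N w) =
          (Polynomial.X - C s) * associated c q + C (momentFunctional c q) := by
        rw [hq, sub_mul, map_sub, associated_X_mul, ← smul_eq_C_mul, map_smul, smul_eq_C_mul]
        ring
      rw [this] at hs'
      simpa using hs'
    rw [hu, mulVec_aeval_eq_momentFunctional_smul h, hmom, zero_smul]
  have hwu : star w ⬝ᵥ u = 0 := by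
    rw [← hDw, star_dotProduct_mulVec_of_isHermitian hD, hDu, dotProduct_zero]
  have horth : ∀ n : ℕ, star ((N ^ n).mulVec w) ⬝ᵥ u = 0 := by
    intro n
    induction n with
    | zero => simpa using hwu
    | succ n ih =>
      rw [pow_succ', ← Matrix.mulVec_mulVec, star_dotProduct_mulVec_of_isHermitian hN, hNu,
        dotProduct_smul, ih, smul_zero]
  have hall : ∀ q : ℂ[X], star ((aeval N q).mulVec w) ⬝ᵥ u = 0 := by
    intro q
    induction q using Polynomial.induction_on' with
    | add p q hp hq => rw [map_add, Matrix.add_mulVec, star_add, add_dotProduct, hp, hq, add_zero]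
    | monomial n a =>
      rw [aeval_monomial, ← Algebra.smul_def, Matrix.smul_mulVec, star_smul, smul_dotProduct,
        horth, smul_zero]
  exact hu0 (dotProduct_star_self_eq_zero.mp (hall q))

/-- The minimal polynomial of `N` relative to a vector has its coefficients in every algebraically
closed subfield containing the entries of `N`, since its roots are eigenvalues of `N`. -/
theorem exists_map_eq_relMinpoly {F : Type*} [Field F] [IsAlgClosed F] [Algebra F ℂ]
    (N : Matrix X X F) (w : X → ℂ) :
    ∃ a : F[X], a.Monic ∧ a.map (algebraMap F ℂ) = relMinpoly (N.map (algebraMap F ℂ)) w := by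
  obtain ⟨hm, -⟩ := relMinpoly_spec (N.map (algebraMap F ℂ)) w
  have hdvd : relMinpoly (N.map (algebraMap F ℂ)) w ∣ N.charpoly.map (algebraMap F ℂ) := by
    refine relMinpoly_dvd ?_
    rw [← Matrix.charpoly_map, Matrix.aeval_self_charpoly,
      Matrix.zero_mulVec]
  have hmem : relMinpoly (N.map (algebraMap F ℂ)) w ∈ lifts (algebraMap F ℂ) := by
    rw [(IsAlgClosed.splits (relMinpoly (N.map (algebraMap F ℂ)) w)).eq_prod_roots_of_monic hm]
    refine Subsemiring.multiset_prod_mem _ _ fun p hp => ?_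
    obtain ⟨z, hz, rfl⟩ := Multiset.mem_map.mp hp
    have hz' : z ∈ (N.charpoly.map (algebraMap F ℂ)).roots :=
      Multiset.mem_of_le (roots.le_of_dvd (N.charpoly_monic.map _).ne_zero hdvd) hz
    rw [(IsAlgClosed.splits N.charpoly).roots_map] at hz'
    obtain ⟨z, -, rfl⟩ := Multiset.mem_map.mp hz'
    rw [mem_lifts]
    exact ⟨Polynomial.X - C z, by simp⟩
  obtain ⟨a, ha, -, ham⟩ := lifts_and_degree_eq_and_monic hmem hm
  exact ⟨a, ham, ha⟩

/-- The perturbed minimal polynomial is a coprime pencil over the field `F` of constants. -/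
theorem exists_relMinpoly_eq_pencil {F : Type*} [Field F] [IsAlgClosed F] [Algebra F ℂ]
    {N : Matrix X X F} {D : Matrix X X ℂ} {w : X → ℂ} {c : ℕ → F} {c' : ℕ → ℂ} {y : ℂ}
    (hN : (N.map (algebraMap F ℂ)).IsHermitian) (hD : D.IsHermitian)
    (hDw : D.mulVec w = w) (hw : w ≠ 0)
    (h : ∀ n, D.mulVec ((N.map (algebraMap F ℂ) ^ n).mulVec w) = algebraMap F ℂ (c n) • w)
    (h' : ∀ n, D.mulVec (((N.map (algebraMap F ℂ) + y • D) ^ n).mulVec w) = c' n • w) :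
    ∃ a : F[X], a.Monic ∧ 0 < a.natDegree ∧ IsCoprime a (associated c a) ∧
      relMinpoly (N.map (algebraMap F ℂ) + y • D) w = pencil a (associated c a) y := by
  obtain ⟨a, ham, ha⟩ := exists_map_eq_relMinpoly N w
  refine ⟨a, ham, ?_, ?_, ?_⟩
  · rw [← natDegree_map (algebraMap F ℂ), ha]
    exact natDegree_relMinpoly_pos _ hw
  · rw [← isCoprime_map (algebraMap F ℂ), associated_map, ha]
    exact isCoprime_associated_relMinpoly hN hD hDw h
  · rw [pencil, associated_map, ha]
    exact relMinpoly_add_smul h h'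

end Krylov
end PGFR

/-! ### Phases from normalized traces -/

namespace PGFR

open Polynomial IntermediateField

section Phase

variable {F : Type*} [Field F]

theorem polyTrace_eq_neg_nextCoeff {p : ℂ[X]} (hp : p.Monic) : polyTrace p = -p.nextCoeff := by
  rw [polyTrace, (IsAlgClosed.splits p).nextCoeff_eq_neg_sum_roots_of_monic hp, neg_neg]

theorem pencil_nextCoeff {A : Type*} [CommRing A] [Nontrivial A] [Algebra F A] {a b : F[X]}
    (hdeg : b.degree < a.degree) (hpos : 0 < a.natDegree)
    (hb : b.coeff (a.natDegree - 1) = 1) (y : A) :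
    (pencil a b y).nextCoeff = algebraMap F A a.nextCoeff - y := by
  rw [nextCoeff_of_natDegree_pos (by rwa [pencil_natDegree hdeg]), pencil_natDegree hdeg,
    nextCoeff_of_natDegree_pos hpos, pencil]
  simp [hb]

/-- An integer multiple `c Q` of a `Q` transcendental over `F` lies in `F` only for `c = 0`. -/
theorem eq_zero_of_intCast_mul_eq_algebraMap [CharZero F] {Ω : Type*} [Field Ω]
    [Algebra F Ω] {Q : Ω}
    (hQ : Transcendental F Q) {c : ℤ} {x : F} (h : (c : Ω) * Q = algebraMap F Ω x) : c = 0 := by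
  by_contra hc
  have hc' : (c : F) ≠ 0 := Int.cast_ne_zero.mpr hc
  refine hQ ?_
  have : Q = algebraMap F Ω (x / c) := by
    rw [map_div₀, map_intCast, ← h, mul_div_cancel_left₀]
    rw [← map_intCast (algebraMap F Ω)]
    exact (_root_.map_ne_zero _).mpr hc'
  rw [this]
  exact isAlgebraic_algebraMap _

/-- There is an additive function on `ℂ` that is constant on the roots of each member of a family of
coprime pencils `aₖ - Q bₖ`, with different values for two members of different degree or trace.
The pencils are irreducible over `F(Q)`, so the normalized trace to `F(Q)` takes the value
`Tr / deg` at all roots of a pencil. It remains to compose it with a rational functional. -/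
theorem exists_phase [CharZero F] [Algebra F ℂ] {Q : ℂ} (hQ : Transcendental F Q) {ι : Type*}
    {a b : ι → F[X]} (ha : ∀ k, (a k).Monic) (hpos : ∀ k, 0 < (a k).natDegree)
    (hdeg : ∀ k, (b k).degree < (a k).degree)
    (hb : ∀ k, (b k).coeff ((a k).natDegree - 1) = 1)
    (hab : ∀ k, IsCoprime (a k) (b k)) {i j : ι}
    (hij : (pencil (a i) (b i) Q).natDegree ≠ (pencil (a j) (b j) Q).natDegree ∨
      polyTrace (pencil (a i) (b i) Q) ≠ polyTrace (pencil (a j) (b j) Q)) :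
    ∃ (g : ℂ →+ ℝ) (θ : ι → ℝ), θ i - θ j = 1 ∧
      ∀ k z, (pencil (a k) (b k) Q).IsRoot z → g z = θ k := by
  let L := algebraicClosure F⟮Q⟯ ℂ
  -- The value `Tr / deg` of the normalized trace at the roots of the `k`-th pencil.
  let x : ι → F⟮Q⟯ := fun k =>
    ((a k).natDegree : F⟮Q⟯)⁻¹ • -(pencil (a k) (b k) (AdjoinSimple.gen F Q)).nextCoeff
  have htrace : ∀ k z, (pencil (a k) (b k) Q).IsRoot z →
      ∃ z' : L, (z' : ℂ) = z ∧ Algebra.normalizedTrace F⟮Q⟯ L z' = x k := by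
    intro k z hz
    have hm := pencil_monic (ha k) (hdeg k) (AdjoinSimple.gen F Q)
    have hb0 : b k ≠ 0 := by
      intro h0
      have := hb k
      rw [h0] at this
      simp at this
    have hroot : aeval z (pencil (a k) (b k) (AdjoinSimple.gen F Q)) = 0 := by
      rw [aeval_def, ← eval_map, pencil_map, AdjoinSimple.algebraMap_gen]
      exact hz
    have hmin := minpoly.eq_of_irreducible_of_monic
      (irreducible_pencil (ha k) hb0 (hab k) (hdeg k) hQ) hroot hm
    have hzL : z ∈ L := (mem_algebraicClosure_iff).mpr ⟨_, hm.ne_zero, hroot⟩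
    refine ⟨⟨z, hzL⟩, rfl, ?_⟩
    have hmin' : minpoly F⟮Q⟯ (⟨z, hzL⟩ : L) = minpoly F⟮Q⟯ z :=
      (minpoly.algebraMap_eq (algebraMap L ℂ).injective (⟨z, hzL⟩ : L)).symm
    rw [Algebra.normalizedTrace_minpoly, hmin', ← hmin, pencil_natDegree (hdeg k)]
  -- Since `Tr (a - Q b) = Q + Tr a`, equality of `Tr / deg` is a relation that is linear in `Q`.
  have hx : x i - x j ≠ 0 := by
    intro h0
    have hc : (((a i).natDegree : ℤ) - (a j).natDegree : ℤ) * Q = algebraMap F ℂ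
        (((a i).natDegree : F) * (a j).nextCoeff - (a j).natDegree * (a i).nextCoeff) := by
      have h1 := congrArg (algebraMap F⟮Q⟯ ℂ) (sub_eq_zero.mp h0)
      simp only [x, pencil_nextCoeff (hdeg _) (hpos _) (hb _), smul_eq_mul, map_mul, map_neg,
        map_sub, map_inv₀, map_natCast, AdjoinSimple.algebraMap_gen,
        ← IsScalarTower.algebraMap_apply] at h1
      have hi : ((a i).natDegree : ℂ) ≠ 0 := Nat.cast_ne_zero.mpr (hpos i).ne'
      have hj : ((a j).natDegree : ℂ) ≠ 0 := Nat.cast_ne_zero.mpr (hpos j).ne'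
      field_simp at h1
      simp only [map_sub, map_mul, map_natCast]
      push_cast
      linear_combination -h1
    have hd : (a i).natDegree = (a j).natDegree := by
      have := eq_zero_of_intCast_mul_eq_algebraMap hQ hc
      omega
    have hn : (a i).nextCoeff = (a j).nextCoeff := by
      rw [hd] at hc
      rw [sub_self, Int.cast_zero, zero_mul, ← mul_sub] at hc
      have h2 := (map_eq_zero (algebraMap F ℂ)).mp hc.symm
      have hj : ((a j).natDegree : F) ≠ 0 := Nat.cast_ne_zero.mpr (hpos j).ne'
      exact (sub_eq_zero.mp ((mul_eq_zero.mp h2).resolve_left hj)).symm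
    rcases hij with hij | hij
    · rw [pencil_natDegree (hdeg i), pencil_natDegree (hdeg j)] at hij
      exact hij hd
    · rw [polyTrace_eq_neg_nextCoeff (pencil_monic (ha i) (hdeg i) Q),
        polyTrace_eq_neg_nextCoeff (pencil_monic (ha j) (hdeg j) Q),
        pencil_nextCoeff (hdeg i) (hpos i) (hb i), pencil_nextCoeff (hdeg j) (hpos j) (hb j),
        hn] at hij
      exact hij rfl
  obtain ⟨φ, hφ⟩ : ∃ φ : Module.Dual ℚ F⟮Q⟯, φ (x i - x j) ≠ 0 := by
    by_contra! h
    exact hx ((Module.forall_dual_apply_eq_zero_iff ℚ _).mp h)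
  -- A rational retraction extends the phase from the algebraic elements to all of `ℂ`.
  obtain ⟨ret, hret⟩ := LinearMap.exists_leftInverse_of_injective
    ((L.val : L →+ ℂ).toRatLinearMap) (LinearMap.ker_eq_bot.mpr L.val.injective)
  refine ⟨((algebraMap ℚ ℝ : ℚ →+ ℝ).comp (((φ (x i - x j))⁻¹ • φ : Module.Dual ℚ F⟮Q⟯) :
      F⟮Q⟯ →+ ℚ)).comp ((Algebra.normalizedTrace F⟮Q⟯ L : L →+ F⟮Q⟯).comp (ret : ℂ →+ L)),
    fun k => algebraMap ℚ ℝ ((φ (x i - x j))⁻¹ * φ (x k)), ?_, ?_⟩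
  · rw [← map_sub, ← mul_sub, ← map_sub, inv_mul_cancel₀ hφ, map_one]
  · intro k z hz
    obtain ⟨z', rfl, hz'⟩ := htrace k z hz
    have h1 : ret (z' : ℂ) = z' := LinearMap.congr_fun hret z'
    simp [h1, hz']

end Phase
end PGFR

/-! ### Vectors with a prescribed symmetry -/

namespace PGFR

open Polynomial

section Equivariant

variable {X : Type*}

theorem mulVec_apply_perm [Fintype X] {A : Matrix X X ℂ} {T : Equiv.Perm X}
    (hA : ∀ x y, A (T x) (T y) = A x y) {ζ : ℂ} {u : X → ℂ} (hu : ∀ x, u (T x) = ζ * u x) (x : X) :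
    A.mulVec u (T x) = ζ * A.mulVec u x := by
  rw [Matrix.mulVec, Matrix.mulVec, dotProduct, dotProduct, ← Equiv.sum_comp T, Finset.mul_sum]
  refine Finset.sum_congr rfl fun y _ => ?_
  rw [hA, hu]
  ring

theorem pow_mulVec_apply_perm [Fintype X] [DecidableEq X] {A : Matrix X X ℂ} {T : Equiv.Perm X}
    (hA : ∀ x y, A (T x) (T y) = A x y) {ζ : ℂ} {u : X → ℂ} (hu : ∀ x, u (T x) = ζ * u x) (n : ℕ)
    (x : X) : (A ^ n).mulVec u (T x) = ζ * (A ^ n).mulVec u x := by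
  induction n generalizing x with
  | zero => simpa using hu x
  | succ n ih =>
    rw [pow_succ', ← Matrix.mulVec_mulVec]
    exact mulVec_apply_perm hA ih x

theorem apply_pow_perm {T : Equiv.Perm X} {ζ : ℂ} {u : X → ℂ} (hu : ∀ x, u (T x) = ζ * u x)
    (m : ℕ) (x : X) : u ((T ^ m) x) = ζ ^ m * u x := by
  induction m with
  | zero => simp
  | succ m ih => rw [pow_succ', Equiv.Perm.mul_apply, hu, ih, pow_succ']; ring

/-- The complex form of the diagonal matrix `D_K`. -/
noncomputable def complexIndicator [DecidableEq X] (K : Finset X) : Matrix X X ℂ :=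
  Matrix.diagonal fun x => if x ∈ K then 1 else 0

theorem complexIndicator_mulVec [Fintype X] [DecidableEq X] (K : Finset X) (u : X → ℂ)
    (x : X) : (complexIndicator K).mulVec u x = if x ∈ K then u x else 0 := by
  rw [complexIndicator, Matrix.mulVec_diagonal]
  split_ifs <;> simp

theorem complexIndicator_isHermitian [DecidableEq X] (K : Finset X) :
    (complexIndicator K).IsHermitian := by
  refine Matrix.isHermitian_diagonal_of_self_adjoint _ (funext fun x => ?_)
  simp only [Pi.star_apply]
  split_ifs <;> simp

theorem perturbed_map [DecidableEq X] (M : Matrix X X ℝ) (Q : ℝ) (K : Finset X) :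
    (perturbed M Q K).map ((↑) : ℝ → ℂ) =
      M.map ((↑) : ℝ → ℂ) + (Q : ℂ) • complexIndicator K := by
  ext x y
  by_cases h : x = y
  · subst h
    by_cases hx : x ∈ K <;> simp [perturbed, diagIndicator, complexIndicator, hx]
  · simp [perturbed, diagIndicator, complexIndicator, h]

end Equivariant

/-! ### Fourier vectors on an orbit -/

section Orbit

theorem apply_mem_orbit_iff {X : Type*} {T : Equiv.Perm X} {K : Finset X} {x₀ : X}
    (hK : (K : Set X) = MulAction.orbit (Subgroup.zpowers T) x₀) (x : X) :
    T x ∈ K ↔ x ∈ K := by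
  rw [← Finset.mem_coe, ← Finset.mem_coe, hK]
  have h := MulAction.orbit_smul (⟨T, Subgroup.mem_zpowers T⟩ : Subgroup.zpowers T) x
  rw [MulAction.mem_orbit_symm, MulAction.mem_orbit_symm (a₁ := x), ← h]
  rfl

theorem isPrimitiveRoot_exp_orderOf {X : Type*} [Finite X] {T : Equiv.Perm X} {r : ℕ}
    (hr : orderOf T = r) :
    IsPrimitiveRoot (Complex.exp (2 * Real.pi * Complex.I / r)) r :=
  Complex.isPrimitiveRoot_exp r (by rw [← hr]; exact (orderOf_pos T).ne')

variable {X : Type*} [Fintype X] [DecidableEq X] {T : Equiv.Perm X} {r : ℕ} {K : Finset X} {x₀ : X}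

theorem orbit_eq_image (hr : orderOf T = r)
    (hK : (K : Set X) = MulAction.orbit (Subgroup.zpowers T) x₀) :
    K = (Finset.range r).image fun m => (T ^ m) x₀ := by
  ext x
  rw [← Finset.mem_coe, hK, Finset.mem_image]
  constructor
  · rintro ⟨⟨S, hS⟩, rfl⟩
    rw [← mem_powers_iff_mem_zpowers, mem_powers_iff_mem_range_orderOf, hr, Finset.mem_image] at hS
    obtain ⟨m, hm, rfl⟩ := hS
    exact ⟨m, hm, rfl⟩
  · rintro ⟨m, -, rfl⟩
    exact ⟨⟨T ^ m, Subgroup.npow_mem_zpowers T m⟩, rfl⟩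

theorem pow_apply_injOn (hr : orderOf T = r)
    (hK : (K : Set X) = MulAction.orbit (Subgroup.zpowers T) x₀) (hcard : K.card = r) :
    Set.InjOn (fun m => (T ^ m) x₀) (Finset.range r) := by
  rw [← Finset.card_image_iff, ← orbit_eq_image hr hK, hcard, Finset.card_range]

theorem zeroExtend_cyclicVec_apply (hr : orderOf T = r)
    (hK : (K : Set X) = MulAction.orbit (Subgroup.zpowers T) x₀) (k : ℕ) (x : X) :
    zeroExtend (cyclicVec T x₀ r K k) x = ∑ m ∈ Finset.range r,
      if (T ^ m) x₀ = x then Complex.exp (2 * Real.pi * Complex.I / r) ^ (m * k) else 0 := by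
  by_cases hx : x ∈ K
  · simp [zeroExtend, cyclicVec, hx]
  · rw [zeroExtend, dif_neg hx]
    refine (Finset.sum_eq_zero fun m hm => if_neg ?_).symm
    rintro rfl
    refine hx ?_
    rw [orbit_eq_image hr hK]
    exact Finset.mem_image_of_mem _ hm

theorem zeroExtend_cyclicVec_perm (hr : orderOf T = r)
    (hK : (K : Set X) = MulAction.orbit (Subgroup.zpowers T) x₀) (k : ℕ) (x : X) :
    zeroExtend (cyclicVec T x₀ r K k) (T x) =
      Complex.exp (2 * Real.pi * Complex.I / r) ^ k * zeroExtend (cyclicVec T x₀ r K k) x := by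
  rw [zeroExtend_cyclicVec_apply hr hK, zeroExtend_cyclicVec_apply hr hK]
  set ρ := Complex.exp (2 * Real.pi * Complex.I / r) with hρ
  have hρr : ρ ^ r = 1 := (isPrimitiveRoot_exp_orderOf hr).pow_eq_one
  -- The summand is periodic with period `r`, so that the summation index may be shifted by one.
  set f : ℕ → ℂ := fun m => if (T ^ m) x₀ = T x then ρ ^ (m * k) else 0 with hf
  have hper : f r = f 0 := by
    have hTr : T ^ r = 1 := by rw [← hr, pow_orderOf_eq_one]
    simp [hf, hTr, pow_mul, hρr]
  have hshift : ∑ m ∈ Finset.range r, f m = ∑ m ∈ Finset.range r, f (m + 1) := by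
    have h1 := Finset.sum_range_succ f r
    rw [Finset.sum_range_succ', hper] at h1
    exact (add_right_cancel h1).symm
  rw [hshift, Finset.mul_sum]
  refine Finset.sum_congr rfl fun m _ => ?_
  simp only [hf, pow_succ', Equiv.Perm.mul_apply, EmbeddingLike.apply_eq_iff_eq, mul_ite, mul_zero]
  rw [add_mul, one_mul, pow_add, mul_comm]

theorem zeroExtend_cyclicVec_base (hr : orderOf T = r)
    (hK : (K : Set X) = MulAction.orbit (Subgroup.zpowers T) x₀) (hcard : K.card = r) (k : ℕ) :
    zeroExtend (cyclicVec T x₀ r K k) x₀ = 1 := by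
  have hr0 : 0 < r := by rw [← hr]; exact orderOf_pos T
  rw [zeroExtend_cyclicVec_apply hr hK, Finset.sum_eq_single_of_mem 0 (Finset.mem_range.mpr hr0)]
  · simp
  · intro m hm hm0
    refine if_neg fun h => hm0 ?_
    exact pow_apply_injOn hr hK hcard hm (Finset.mem_coe.mpr (Finset.mem_range.mpr hr0))
      (by simpa using h)

/-- Restricted to the orbit `K`, a vector with the same `T`-eigenvalue as `v_k` is a multiple of
`v_k`. -/
theorem complexIndicator_mulVec_of_equivariant (hr : orderOf T = r)
    (hK : (K : Set X) = MulAction.orbit (Subgroup.zpowers T) x₀) (hcard : K.card = r) (k : ℕ)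
    {u : X → ℂ} (hu : ∀ x, u (T x) = Complex.exp (2 * Real.pi * Complex.I / r) ^ k * u x) :
    (complexIndicator K).mulVec u = u x₀ • zeroExtend (cyclicVec T x₀ r K k) := by
  ext x
  rw [complexIndicator_mulVec, Pi.smul_apply, smul_eq_mul]
  split_ifs with hx
  · rw [orbit_eq_image hr hK] at hx
    obtain ⟨m, -, rfl⟩ := Finset.mem_image.mp hx
    rw [apply_pow_perm hu, apply_pow_perm (zeroExtend_cyclicVec_perm hr hK k),
      zeroExtend_cyclicVec_base hr hK hcard]
    ring
  · rw [zeroExtend, dif_neg hx, mul_zero]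

/-- Fourier inversion on the orbit. -/
theorem single_eq_sum_cyclicVec (hr : orderOf T = r)
    (hK : (K : Set X) = MulAction.orbit (Subgroup.zpowers T) x₀) (hcard : K.card = r) {x : X}
    (hx : x ∈ K) : ∃ c : ℕ → ℂ, (Pi.single x 1 : X → ℂ) =
      ∑ k ∈ Finset.range r, c k • zeroExtend (cyclicVec T x₀ r K k) := by
  have hr0 : 0 < r := by rw [← hr]; exact orderOf_pos T
  rw [orbit_eq_image hr hK] at hx
  obtain ⟨m, hm, rfl⟩ := Finset.mem_image.mp hx
  have hρ := isPrimitiveRoot_exp_orderOf hr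
  set ρ := Complex.exp (2 * Real.pi * Complex.I / r)
  have hρ0 : ρ ≠ 0 := hρ.ne_zero hr0.ne'
  refine ⟨fun k => (r : ℂ)⁻¹ * ((ρ ^ m) ^ k)⁻¹, funext fun y => ?_⟩
  rw [Finset.sum_apply]
  simp only [Pi.smul_apply, smul_eq_mul]
  by_cases hy : y ∈ K
  · rw [orbit_eq_image hr hK] at hy
    obtain ⟨l, hl, rfl⟩ := Finset.mem_image.mp hy
    have hterm : ∀ k ∈ Finset.range r, (r : ℂ)⁻¹ * ((ρ ^ m) ^ k)⁻¹ *
        zeroExtend (cyclicVec T x₀ r K k) ((T ^ l) x₀) = (r : ℂ)⁻¹ * (ρ ^ l / ρ ^ m) ^ k := by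
      intro k _
      have hval : zeroExtend (cyclicVec T x₀ r K k) ((T ^ l) x₀) = (ρ ^ l) ^ k := by
        rw [apply_pow_perm (zeroExtend_cyclicVec_perm hr hK k),
          zeroExtend_cyclicVec_base hr hK hcard, mul_one, pow_right_comm]
      rw [hval, div_pow, div_eq_mul_inv]
      ring
    rw [Finset.sum_congr rfl hterm, ← Finset.mul_sum]
    by_cases hlm : l = m
    · subst hlm
      rw [Pi.single_eq_same, div_self (pow_ne_zero _ hρ0)]
      simp [hr0.ne']
    · have hne : ρ ^ l / ρ ^ m ≠ 1 := by
        rw [Ne, div_eq_one_iff_eq (pow_ne_zero _ hρ0)]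
        exact fun h => hlm (hρ.pow_inj (Finset.mem_range.mp hl) (Finset.mem_range.mp hm) h)
      rw [Pi.single_eq_of_ne (fun h => hlm (pow_apply_injOn hr hK hcard hl hm h)), geom_sum_eq hne,
        div_pow, pow_right_comm, hρ.pow_eq_one, pow_right_comm, hρ.pow_eq_one]
      simp
  · rw [Pi.single_eq_of_ne (by rintro rfl; exact hy (by rw [orbit_eq_image hr hK]; exact hx))]
    refine (Finset.sum_eq_zero fun k _ => ?_).symm
    rw [zeroExtend, dif_neg hy, mul_zero]

end Orbit

/-! ### Spectral calculus and blocks -/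

section Spectral

variable {X : Type*} [Fintype X] [DecidableEq X] {A : Matrix X X ℂ}

/-- The matrix with the same eigenvectors as `A` and the entries of `d` as eigenvalues. -/
noncomputable def withEigenvalues (hA : A.IsHermitian) (d : X → ℂ) : Matrix X X ℂ :=
  (hA.eigenvectorUnitary : Matrix X X ℂ) * Matrix.diagonal d *
    star (hA.eigenvectorUnitary : Matrix X X ℂ)

theorem withEigenvalues_eigenvalues (hA : A.IsHermitian) :
    withEigenvalues hA (fun a => (hA.eigenvalues a : ℂ)) = A := by
  conv_rhs => rw [hA.spectral_theorem, Unitary.conjStarAlgAut_apply]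
  rfl

theorem continuous_withEigenvalues (hA : A.IsHermitian) : Continuous (withEigenvalues hA) := by
  unfold withEigenvalues
  fun_prop

theorem exp_smul_eq_withEigenvalues (hA : A.IsHermitian) (c : ℂ) :
    NormedSpace.exp (c • A) =
      withEigenvalues hA fun a => Complex.exp (c * hA.eigenvalues a) := by
  set W := (hA.eigenvectorUnitary : Matrix X X ℂ) with hW
  have hinv : W⁻¹ = star W := Matrix.inv_eq_left_inv (Unitary.coe_star_mul_self _)
  have hcA : c • A = W * Matrix.diagonal (fun a => c * (hA.eigenvalues a : ℂ)) * W⁻¹ := by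
    conv_lhs => rw [← withEigenvalues_eigenvalues hA]
    rw [withEigenvalues, hinv, ← hW, ← Matrix.smul_mul, ← Matrix.mul_smul, ← Matrix.diagonal_smul]
    rfl
  rw [hcA, Matrix.exp_conj _ _ (Matrix.isUnit_iff_isUnit_det _ |>.mpr
    (Matrix.isUnit_det_of_left_inverse (Unitary.coe_star_mul_self hA.eigenvectorUnitary))),
    Matrix.exp_diagonal, hinv, withEigenvalues]
  congr 3
  ext a
  rw [Pi.coe_exp, Complex.exp_eq_exp_ℂ]

theorem star_withEigenvalues_mul_self (hA : A.IsHermitian) {d : X → ℂ}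
    (hd : ∀ a, star (d a) * d a = 1) :
    star (withEigenvalues hA d) * withEigenvalues hA d = 1 := by
  have hD : star (Matrix.diagonal d) * Matrix.diagonal d = 1 := by
    rw [Matrix.star_eq_conjTranspose, Matrix.diagonal_conjTranspose, Matrix.diagonal_mul_diagonal,
      ← Matrix.diagonal_one]
    congr 1
    exact funext hd
  have hW := Unitary.coe_star_mul_self hA.eigenvectorUnitary
  have hW' : (hA.eigenvectorUnitary : Matrix X X ℂ) *
      star (hA.eigenvectorUnitary : Matrix X X ℂ) = 1 :=
    Unitary.coe_mul_star_self hA.eigenvectorUnitary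
  rw [withEigenvalues, star_mul, star_mul, star_star]
  set W := (hA.eigenvectorUnitary : Matrix X X ℂ)
  calc _ = W * (star (Matrix.diagonal d) * (star W * W) * Matrix.diagonal d) * star W := by
        simp only [mul_assoc]
    _ = 1 := by rw [hW, mul_one, hD, mul_one, hW']

theorem star_eigenvectorUnitary_mulVec_aeval (hA : A.IsHermitian) (p : ℂ[X]) (w : X → ℂ) (a : X) :
    (star (hA.eigenvectorUnitary : Matrix X X ℂ)).mulVec ((aeval A p).mulVec w) a =
      p.eval (hA.eigenvalues a : ℂ) *
        (star (hA.eigenvectorUnitary : Matrix X X ℂ)).mulVec w a := by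
  have hstep : ∀ u : X → ℂ, (star (hA.eigenvectorUnitary : Matrix X X ℂ)).mulVec (A.mulVec u) a =
      (hA.eigenvalues a : ℂ) * (star (hA.eigenvectorUnitary : Matrix X X ℂ)).mulVec u a := by
    intro u
    have hu := congrArg (fun B => B.mulVec u) (withEigenvalues_eigenvalues hA)
    rw [← hu, withEigenvalues, ← Matrix.mulVec_mulVec, ← Matrix.mulVec_mulVec,
      Matrix.mulVec_mulVec, Unitary.coe_star_mul_self, Matrix.one_mulVec, Matrix.mulVec_diagonal]
  have hpow : ∀ n : ℕ, (star (hA.eigenvectorUnitary : Matrix X X ℂ)).mulVec ((A ^ n).mulVec w) a =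
      (hA.eigenvalues a : ℂ) ^ n *
        (star (hA.eigenvectorUnitary : Matrix X X ℂ)).mulVec w a := by
    intro n
    induction n with
    | zero => simp
    | succ n ih =>
      rw [pow_succ', ← Matrix.mulVec_mulVec, hstep, ih]
      ring
  induction p using Polynomial.induction_on' with
  | add p q hp hq =>
    rw [map_add, Matrix.add_mulVec, Matrix.mulVec_add, Pi.add_apply, hp, hq, eval_add, add_mul]
  | monomial n c =>
    rw [aeval_monomial, ← Algebra.smul_def, Matrix.smul_mulVec, Matrix.mulVec_smul, Pi.smul_apply,
      hpow, eval_monomial, smul_eq_mul, mul_assoc]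

/-- If `d` is constant on the eigenvalues that are roots of the minimal polynomial relative to `w`,
then `w` is an eigenvector of `withEigenvalues hA d`. -/
theorem withEigenvalues_mulVec (hA : A.IsHermitian) {w : X → ℂ} {d : X → ℂ} {γ : ℂ}
    (hd : ∀ a, (relMinpoly A w).IsRoot (hA.eigenvalues a : ℂ) → d a = γ) :
    (withEigenvalues hA d).mulVec w = γ • w := by
  have h1 : (Matrix.diagonal d).mulVec ((star (hA.eigenvectorUnitary : Matrix X X ℂ)).mulVec w) =
      γ • (star (hA.eigenvectorUnitary : Matrix X X ℂ)).mulVec w := by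
    ext a
    rw [Matrix.mulVec_diagonal, Pi.smul_apply, smul_eq_mul]
    by_cases h0 : (star (hA.eigenvectorUnitary : Matrix X X ℂ)).mulVec w a = 0
    · rw [h0, mul_zero, mul_zero]
    · rw [hd a]
      have h2 := star_eigenvectorUnitary_mulVec_aeval hA (relMinpoly A w) w a
      rw [(relMinpoly_spec A w).2, Matrix.mulVec_zero, Pi.zero_apply] at h2
      exact (mul_eq_zero.mp h2.symm).resolve_right h0
  have hW : (hA.eigenvectorUnitary : Matrix X X ℂ) *
      star (hA.eigenvectorUnitary : Matrix X X ℂ) = 1 :=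
    Unitary.coe_mul_star_self hA.eigenvectorUnitary
  rw [withEigenvalues, ← Matrix.mulVec_mulVec, ← Matrix.mulVec_mulVec, h1, Matrix.mulVec_smul,
    Matrix.mulVec_mulVec, hW, Matrix.one_mulVec]

/-- The `K × K` block of a unitary matrix that maps vectors supported on `K` to such vectors. -/
theorem block_mem_unitaryGroup {U : Matrix X X ℂ} {K : Finset X} (hU : star U * U = 1)
    (hK : ∀ x ∈ K, ∀ y ∉ K, U y x = 0) : block U K ∈ Matrix.unitaryGroup K ℂ := by
  rw [Matrix.mem_unitaryGroup_iff']
  ext x y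
  have h := congrFun (congrFun hU x) y
  rw [Matrix.mul_apply] at h ⊢
  rw [Matrix.one_apply] at h ⊢
  simp only [Subtype.ext_iff]
  rw [← h]
  rw [← Finset.sum_subset (Finset.subset_univ K) fun z _ hz => by rw [hK y y.2 z hz, mul_zero]]
  exact Finset.sum_coe_sort K fun z => star U x z * U z y

theorem block_mulVec {U : Matrix X X ℂ} {K : Finset X} (v : K → ℂ) (x : K) :
    (block U K).mulVec v x = U.mulVec (zeroExtend v) x := by
  rw [Matrix.mulVec, Matrix.mulVec, dotProduct, dotProduct,
    ← Finset.sum_subset (Finset.subset_univ K) fun z _ hz => by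
      rw [zeroExtend, dif_neg hz, mul_zero]]
  rw [← Finset.sum_coe_sort K fun z => U x z * zeroExtend v z]
  refine Finset.sum_congr rfl fun z _ => ?_
  simp [block, zeroExtend]

/-- Kronecker approximation of the eigenphases: replacing each eigenvalue `l` by `exp (i g(l))`
gives a limit of the evolution at nonnegative times. -/
theorem block_exp_mem_closure {M : Matrix X X ℝ} (hA : (M.map ((↑) : ℝ → ℂ)).IsHermitian)
    (K : Finset X) (g : ℝ →+ ℝ) :
    block (withEigenvalues hA fun a => Complex.exp (Complex.I * g (hA.eigenvalues a))) K ∈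
      closure {B : Matrix K K ℂ | ∃ t : ℝ, 0 ≤ t ∧ B = block (evolution M t) K} := by
  have hcont : Continuous fun d : X → ℂ => block (withEigenvalues hA d) K :=
    (continuous_withEigenvalues hA).matrix_submatrix _ _
  have hmem : (fun a => Complex.exp (Complex.I * g (hA.eigenvalues a))) ∈
      closure {d : X → ℂ | ∃ t : ℝ, 0 ≤ t ∧
        d = fun a => Complex.exp (Complex.I * t * hA.eigenvalues a)} := by
    rw [Metric.mem_closure_iff]
    intro ε hε
    obtain ⟨t, ht, h⟩ := exists_time_exp_near g hA.eigenvalues hε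
    refine ⟨_, ⟨t, ht, rfl⟩, ?_⟩
    rw [dist_comm, dist_pi_lt_iff hε]
    exact fun a => by rw [dist_eq_norm]; exact h a
  refine closure_mono ?_ (image_closure_subset_closure_image hcont ⟨_, hmem, rfl⟩)
  rintro _ ⟨_, ⟨t, ht, rfl⟩, rfl⟩
  exact ⟨t, ht, by rw [evolution, exp_smul_eq_withEigenvalues hA]⟩

end Spectral
end PGFR

/-! ### Minimal polynomials of the cyclic vectors and fractional revival -/

namespace PGFR

open Polynomial

theorem exists_map_algebraicClosure_eq {ι : Type*} {f : ι → ℂ} (hf : ∀ x, IsAlgebraic ℚ (f x)) :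
    ∃ f' : ι → algebraicClosure ℚ ℂ, ∀ x, algebraMap (algebraicClosure ℚ ℂ) ℂ (f' x) = f x :=
  ⟨fun x => ⟨f x, mem_algebraicClosure_iff.mpr (hf x)⟩, fun _ => rfl⟩

theorem transcendental_ofReal {Q : ℝ} (hQ : Transcendental ℚ Q) :
    Transcendental (algebraicClosure ℚ ℂ) (Q : ℂ) := by
  refine Transcendental.algebraicClosure ?_
  exact (transcendental_algebraMap_iff (A := ℂ) (algebraMap ℝ ℂ).injective).mpr hQ

section Cyclic

variable {X : Type*} [Fintype X] [DecidableEq X] {T : Equiv.Perm X} {r : ℕ} {K : Finset X} {x₀ : X}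

/-- The polynomial `P_k` is a coprime pencil `a - Q b` over the algebraic numbers, with `b` monic of
degree one less than `a`. -/
theorem exists_cyclicFactor_eq_pencil (G : WeightedGraph X) (hT : G.IsAutomorphism T)
    (hr : orderOf T = r) (hK : (K : Set X) = MulAction.orbit (Subgroup.zpowers T) x₀)
    (hcard : K.card = r) (Q : ℝ) (k : ℕ) :
    ∃ a b : (algebraicClosure ℚ ℂ)[X], a.Monic ∧ 0 < a.natDegree ∧ b.degree < a.degree ∧
      b.coeff (a.natDegree - 1) = 1 ∧ IsCoprime a b ∧
      cyclicFactor G.adjMatrix Q T x₀ r K k = pencil a b (Q : ℂ) := by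
  have : IsAlgClosed (algebraicClosure ℚ ℂ) := (algebraicClosure.isAlgClosure ℚ ℂ).isAlgClosed
  set w := zeroExtend (cyclicVec T x₀ r K k) with hw
  have hbase : w x₀ = 1 := zeroExtend_cyclicVec_base hr hK hcard k
  have hperm : ∀ x, w (T x) = _ := zeroExtend_cyclicVec_perm hr hK k
  obtain ⟨m, hm⟩ := exists_map_algebraicClosure_eq
    (f := fun p : X × X => (G.weight p.1 p.2 : ℂ)) fun p => (G.weight_algebraic p.1 p.2).algebraMap
  obtain ⟨w', hw'⟩ := exists_map_algebraicClosure_eq (f := w) fun x => by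
    rw [hw, zeroExtend_cyclicVec_apply hr hK]
    refine (IsIntegral.sum _ fun l _ => ?_).isAlgebraic
    split_ifs
    · exact (((isPrimitiveRoot_exp_orderOf hr).isIntegral
        (by rw [← hr]; exact orderOf_pos T)).tower_top (A := ℚ)).pow _
    · exact isIntegral_zero
  let N : Matrix X X (algebraicClosure ℚ ℂ) := Matrix.of fun x y => m (x, y)
  have hN : N.map (algebraMap _ ℂ) = G.adjMatrix.map ((↑) : ℝ → ℂ) := by
    ext x y
    exact hm (x, y)
  have hNherm : (N.map (algebraMap _ ℂ)).IsHermitian := by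
    rw [hN]
    ext x y
    simp [WeightedGraph.adjMatrix, G.weight_comm y x]
  have hNT : ∀ x y, N.map (algebraMap _ ℂ) (T x) (T y) = N.map (algebraMap _ ℂ) x y := by
    intro x y
    rw [hN]
    simp [WeightedGraph.adjMatrix, hT x y]
  have hAT : ∀ x y, (N.map (algebraMap _ ℂ) + (Q : ℂ) • complexIndicator K) (T x) (T y) =
      (N.map (algebraMap _ ℂ) + (Q : ℂ) • complexIndicator K) x y := by
    intro x y
    rw [Matrix.add_apply, hNT, Matrix.add_apply]
    simp [complexIndicator, Matrix.diagonal_apply, apply_mem_orbit_iff hK]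
  let c : ℕ → algebraicClosure ℚ ℂ := fun n => (N ^ n).mulVec w' x₀
  have hc : ∀ n, algebraMap _ ℂ (c n) = ((N.map (algebraMap _ ℂ)) ^ n).mulVec w x₀ := by
    intro n
    rw [← Matrix.map_pow, RingHom.map_mulVec]
    congr 2
    exact funext hw'
  obtain ⟨a, ham, hpos, hcop, ha⟩ := exists_relMinpoly_eq_pencil (N := N) (D := complexIndicator K)
    (w := w) (c := c) (y := (Q : ℂ))
    (c' := fun n => ((N.map (algebraMap _ ℂ) + (Q : ℂ) • complexIndicator K) ^ n).mulVec w x₀)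
    hNherm (complexIndicator_isHermitian K)
    (by rw [complexIndicator_mulVec_of_equivariant hr hK hcard k hperm, hbase, one_smul])
    (fun h0 => by rw [h0] at hbase; exact zero_ne_one hbase)
    (fun n => by
      rw [hc, complexIndicator_mulVec_of_equivariant hr hK hcard k
        (pow_mulVec_apply_perm hNT hperm n)])
    (fun n => complexIndicator_mulVec_of_equivariant hr hK hcard k
        (pow_mulVec_apply_perm hAT hperm n))
  refine ⟨a, associated c a, ham, hpos, degree_associated_lt c ham.ne_zero, ?_, hcop, ?_⟩
  · rw [coeff_associated_of_monic c ham (Nat.sub_add_cancel hpos).symm]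
    apply (algebraMap (algebraicClosure ℚ ℂ) ℂ).injective
    rw [hc, pow_zero, Matrix.one_mulVec, hbase, map_one]
  · rw [cyclicFactor, perturbed_map, ← hN, ← ha]

/-- A matrix having all `v_k` as eigenvectors maps vectors supported on `K` to such vectors. -/
theorem apply_eq_zero_of_cyclicVec_eigenvector (hr : orderOf T = r)
    (hK : (K : Set X) = MulAction.orbit (Subgroup.zpowers T) x₀) (hcard : K.card = r)
    {U : Matrix X X ℂ} {γ : ℕ → ℂ}
    (hU : ∀ k, U.mulVec (zeroExtend (cyclicVec T x₀ r K k)) =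
      γ k • zeroExtend (cyclicVec T x₀ r K k)) {x y : X} (hx : x ∈ K) (hy : y ∉ K) :
    U y x = 0 := by
  obtain ⟨c, hc⟩ := single_eq_sum_cyclicVec hr hK hcard hx
  have h : U y x = U.mulVec (Pi.single x 1) y := by
    rw [Matrix.mulVec_single_one]
    rfl
  rw [h, hc, Matrix.mulVec_sum, Finset.sum_apply]
  refine Finset.sum_eq_zero fun k _ => ?_
  rw [Matrix.mulVec_smul, hU, Pi.smul_apply, Pi.smul_apply, zeroExtend, dif_neg hy, smul_zero,
    smul_zero]

theorem block_ne_smul_one_of_cyclicVec_eigenvector (hr : orderOf T = r)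
    (hK : (K : Set X) = MulAction.orbit (Subgroup.zpowers T) x₀) (hcard : K.card = r)
    {U : Matrix X X ℂ} {γ : ℕ → ℂ}
    (hU : ∀ k, U.mulVec (zeroExtend (cyclicVec T x₀ r K k)) =
      γ k • zeroExtend (cyclicVec T x₀ r K k)) {i j : ℕ} (hij : γ i ≠ γ j) (c : ℂ) :
    block U K ≠ c • (1 : Matrix K K ℂ) := by
  intro h
  have hx₀ : x₀ ∈ K := by
    rw [← Finset.mem_coe, hK]
    exact MulAction.mem_orbit_self x₀
  have hγ : ∀ k, c = γ k := by
    intro k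
    have h1 := block_mulVec (U := U) (cyclicVec T x₀ r K k) ⟨x₀, hx₀⟩
    have h2 : cyclicVec T x₀ r K k ⟨x₀, hx₀⟩ = 1 := by
      rw [← zeroExtend_cyclicVec_base hr hK hcard k, zeroExtend, dif_pos hx₀]
    rw [h, Matrix.smul_mulVec, Matrix.one_mulVec, hU, Pi.smul_apply, Pi.smul_apply, h2,
      zeroExtend_cyclicVec_base hr hK hcard, smul_eq_mul, smul_eq_mul, mul_one, mul_one] at h1
    exact h1
  exact hij ((hγ i).symm.trans (hγ j))

theorem exp_I_mul_ne_of_sub_eq_one {s t : ℝ} (h : s - t = 1) :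
    Complex.exp (Complex.I * s) ≠ Complex.exp (Complex.I * t) := by
  rw [Ne, Complex.exp_eq_exp_iff_exists_int]
  rintro ⟨n, hn⟩
  have h1 : (s : ℂ) = t + n * (2 * Real.pi) := by
    apply mul_left_cancel₀ Complex.I_ne_zero
    rw [hn]
    ring
  have h2 : (1 : ℝ) = n * (2 * Real.pi) := by
    rw [← h, sub_eq_iff_eq_add']
    exact_mod_cast h1
  have hpi := Real.pi_gt_three
  rcases le_or_gt n 0 with hn | hn
  · have : (n : ℝ) ≤ 0 := by exact_mod_cast hn
    nlinarith
  · have : (1 : ℝ) ≤ n := by exact_mod_cast hn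
    nlinarith

end Cyclic

end PGFR

open PGFR in
theorem mainTheorem9 {V : Type*} [Fintype V] [DecidableEq V]
    (G : PGFR.WeightedGraph V) (T : Equiv.Perm V) (hT : G.IsAutomorphism T)
    (r : ℕ) (hr : orderOf T = r)
    (K : Finset V) (x₀ : V)
    (hK : (K : Set V) = MulAction.orbit (Subgroup.zpowers T) x₀) (hcard : K.card = r)
    (Q : ℝ) (hQ : Transcendental ℚ Q)
    (i j : ℕ) (hi : 1 ≤ i ∧ i ≤ r) (hj : 1 ≤ j ∧ j ≤ r)
    (h : (PGFR.cyclicFactor G.adjMatrix Q T x₀ r K i).natDegree ≠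
          (PGFR.cyclicFactor G.adjMatrix Q T x₀ r K j).natDegree ∨
        PGFR.polyTrace (PGFR.cyclicFactor G.adjMatrix Q T x₀ r K i) ≠
          PGFR.polyTrace (PGFR.cyclicFactor G.adjMatrix Q T x₀ r K j)) :
    PGFR.HasPGFR (PGFR.perturbed G.adjMatrix Q K) K := by
  choose a b ham hpos hdeg hb hcop hP using exists_cyclicFactor_eq_pencil G hT hr hK hcard Q
  rw [hP, hP] at h
  obtain ⟨g, θ, hθ, hg⟩ := exists_phase (transcendental_ofReal hQ) ham hpos hdeg hb hcop h
  have hA : ((perturbed G.adjMatrix Q K).map ((↑) : ℝ → ℂ)).IsHermitian := by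
    rw [perturbed_map]
    refine Matrix.IsHermitian.add ?_ ?_
    · ext x y
      simp [WeightedGraph.adjMatrix, G.weight_comm y x]
    · exact (complexIndicator_isHermitian K).smul (Complex.conj_ofReal Q)
  let g' : ℝ →+ ℝ := g.comp (Complex.ofRealHom : ℝ →+ ℂ)
  -- This limit of the evolution multiplies `v_k` by `exp (i θ_k)`.
  set U := withEigenvalues hA fun a => Complex.exp (Complex.I * g' (hA.eigenvalues a)) with hU
  have hUv : ∀ k, U.mulVec (zeroExtend (cyclicVec T x₀ r K k)) =
      Complex.exp (Complex.I * θ k) • zeroExtend (cyclicVec T x₀ r K k) := by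
    intro k
    refine withEigenvalues_mulVec hA fun a ha => ?_
    have hroot : (cyclicFactor G.adjMatrix Q T x₀ r K k).IsRoot (hA.eigenvalues a : ℂ) := ha
    rw [hP] at hroot
    change Complex.exp (Complex.I * (g (hA.eigenvalues a : ℂ) : ℝ)) = _
    rw [hg k _ hroot]
  have hUU : star U * U = 1 := star_withEigenvalues_mul_self hA fun a => by
    rw [Complex.star_def, ← Complex.exp_conj, ← Complex.exp_add]
    simp
  intro hsub
  obtain ⟨c, hc⟩ := hsub ⟨block_exp_mem_closure hA K g', block_mem_unitaryGroup hUU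
    fun x hx y hy => apply_eq_zero_of_cyclicVec_eigenvector hr hK hcard hUv hx hy⟩
  exact block_ne_smul_one_of_cyclicVec_eigenvector hr hK hcard hUv
    (exp_I_mul_ne_of_sub_eq_one hθ) c hc
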